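/- Let $x=(x(t))_{t\in\mathbb R}$ be a real, jointly measurable, zero-mean stationary Gaussian process with covariance $\operatorname{Cov}(x(s),x(t))=K_x(s-t)$, where $K_x\in L^1(\mathbb R)\cup L^2(\mathbb R)$. Let $h:\mathbb R\to\mathbb R$ be a filter, $h\in L^1(\mathbb R)\cup L^2(\mathbb R)$, such that for every $t\in\mathbb R$ the integral $$f(t)=\int_{\mathbb R}x(\tau)\,h(\tau-t)\,d\tau=\lim_{R\to\infty}\int_{-R}^{R}x(\tau)\,h(\tau-t)\,d\tau$$ converges in probability (this is the ordinary Lebesgue integral whenever $\tau\mapsto x(\tau)h(\tau-t)$ is almost surely integrable). Let $\sigma_n^2\ge 0$ and, for every $N$, let $t_{N,1},\dots,t_{N,N}\in\mathbb R$ be observation times and $\mathbf y_N=(y_{N,1},\dots,y_{N,N})$ observations with $y_{N,i}\sim\mathcal N(f(t_{N,i}),\sigma_n^2)$, i.e. the residuals $y_{N,i}-f(t_{N,i})$, $i\le N$, are i.i.d. $\mathcal N(0,\sigma_n^2)$ and independent of $x$. For an integrable, compactly supported window $w:\mathbb R\to\mathbb R$ and $\xi\in\mathbb R$ put $$\hat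 x_w(\xi)=\mathcal F[w\,x](\xi)=\int_{\mathbb R}w(t)\,x(t)\,e^{-2\pi i\xi t}\,dt .$$ Suppose that $x$ is successfully recovered from the observations: for every $\xi\in\mathbb R$ and every such window $w$, the posterior variance $$\mathbb E\Big[\big|\hat x_w(\xi)-\mathbb E[\hat x_w(\xi)\mid \mathbf y_N]\big|^2\;\Big|\;\mathbf y_N\Big]$$ tends to $0$ almost surely as $N\to\infty$. Then $$\operatorname{supp}\mathcal F[K_x]\subseteq\operatorname{supp}\mathcal F[h],$$ where $\operatorname{supp}$ is the closed support and $\mathcal F$ is understood in the sense of tempered distributions (for an integrable function $g$, $\operatorname{supp}\mathcal F[g]$ is the closure of $\{\xi:\mathcal F[g](\xi)\neq0\}$). -/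

import Mathlib

open MeasureTheory ProbabilityTheory Filter Topology
open scoped FourierTransform SchwartzMap NNReal

noncomputable section

namespace GPDeconv

/-- The spectral support `supp 𝓕[g]` of a function `g`, for `g` in some `L^p`, `1 ≤ p`: the (closed)
support of the tempered distribution `𝓕[g] : φ ↦ ∫ g(t) (𝓕 φ)(t) dt`. For integrable `g` this is the
closed support of the function `𝓕 g` (`spectralSupport_eq_tsupport`); the distributional form also
gives a meaning to the Fourier transform of non-integrable functions such as the sinc. -/
def spectralSupport (g : ℝ → ℝ) : Set ℝ :=
  Distribution.dsupport fun φ : 𝓢(ℝ, ℂ) ↦ ∫ t, (g t : ℂ) * (𝓕 φ : 𝓢(ℝ, ℂ)) t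

variable {Ω : Type*} [MeasurableSpace Ω]

/-- `x` is a (jointly measurable, real) zero-mean stationary Gaussian process with covariance
kernel `Kx`. -/
structure IsSource (μ : Measure Ω) (x : ℝ → Ω → ℝ) (Kx : ℝ → ℝ) : Prop where
  measurable : Measurable (Function.uncurry x)
  gaussian : IsGaussianProcess x μ
  mean_zero : ∀ t, ∫ ω, x t ω ∂μ = 0
  cov_eq : ∀ s t, cov[x s, x t; μ] = Kx (s - t)

/-- `f(t) = ∫ x(τ) h(τ - t) dτ` for every `t`, as an (improper) integral over `ℝ` that converges in
probability. If `τ ↦ x(τ) h(τ - t)` is almost surely Lebesgue integrable, this is the Lebesgue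
integral. -/
structure IsConvolution (μ : Measure Ω) (x : ℝ → Ω → ℝ) (h : ℝ → ℝ) (f : ℝ → Ω → ℝ) : Prop where
  measurable : ∀ t, Measurable (f t)
  tendsto : ∀ t, TendstoInMeasure μ
    (fun (R : ℝ) ω ↦ ∫ τ in (-R)..R, x τ ω * h (τ - t)) atTop (f t)

/-- `y₁, …, y_N` are noisy observations `yᵢ ∼ 𝒩(f(tᵢ), v)`: the residuals `yᵢ - f(tᵢ)` are
i.i.d. `𝒩(0, v)` and independent of the source process. -/
structure IsObservation (μ : Measure Ω) (x f : ℝ → Ω → ℝ) (v : ℝ≥0) {N : ℕ}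
    (t : Fin N → ℝ) (y : Fin N → Ω → ℝ) : Prop where
  measurable : ∀ i, Measurable (y i)
  law : ∀ i, HasLaw (fun ω ↦ y i ω - f (t i) ω) (gaussianReal 0 v) μ
  indep : iIndepFun (fun i ω ↦ y i ω - f (t i) ω) μ
  indep_source : IndepFun (fun ω τ ↦ x τ ω) (fun ω i ↦ y i ω - f (t i) ω) μ

/-- The windowed spectrum `x̂_w(ξ) = 𝓕[w x](ξ) = ∫ w(t) x(t) e^{-2πiξt} dt`. -/
def windowedSpectrum (x : ℝ → Ω → ℝ) (w : ℝ → ℝ) (ξ : ℝ) (ω : Ω) : ℂ :=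
  𝓕 (fun t : ℝ ↦ ((w t * x t ω : ℝ) : ℂ)) ξ

/-- The posterior variance `E[ |Z - E[Z | y]|² | y ]` of a complex random variable `Z`, given the
observations `y`. -/
def posteriorVariance (μ : Measure Ω) {N : ℕ} (Z : Ω → ℂ) (y : Fin N → Ω → ℝ) : Ω → ℝ :=
  let m : MeasurableSpace Ω := MeasurableSpace.comap (fun ω i ↦ y i ω) MeasurableSpace.pi
  μ[fun ω ↦ ‖Z ω - (μ[Z | m]) ω‖ ^ 2 | m]

/-- Successful recovery of `x` as the number `N` of observations `y N 0, …, y N (N-1)` grows: for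
every frequency and every compactly supported (integrable) window, the posterior variance of the
windowed spectrum tends to zero, almost surely. -/
def SuccessfullyRecovered (μ : Measure Ω) (x : ℝ → Ω → ℝ) (y : (N : ℕ) → Fin N → Ω → ℝ) : Prop :=
  ∀ (ξ : ℝ) (w : ℝ → ℝ), Integrable w → HasCompactSupport w →
    ∀ᵐ ω ∂μ, Tendsto (fun N ↦ posteriorVariance μ (windowedSpectrum x w ξ) (y N) ω) atTop (𝓝 0)

theorem spectralSupport_eq_tsupport {g : ℝ → ℝ} (hg : Integrable g) :
    spectralSupport g = tsupport (𝓕 fun t ↦ (g t : ℂ)) := by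
  set G : ℝ → ℂ := 𝓕 fun t ↦ (g t : ℂ) with hG
  have hgc : Integrable fun t ↦ (g t : ℂ) := hg.ofReal
  have hcont : Continuous G :=
    VectorFourier.fourierIntegral_continuous Real.continuous_fourierChar
      (L := innerₗ ℝ) continuous_inner hgc
  have key (φ : 𝓢(ℝ, ℂ)) : ∫ t, (g t : ℂ) * (𝓕 φ : 𝓢(ℝ, ℂ)) t = ∫ ξ, G ξ * φ ξ := by
    simpa [SchwartzMap.fourier_coe] using! (VectorFourier.integral_fourierIntegral_smul_eq_flip
      (L := innerₗ ℝ) Real.continuous_fourierChar continuous_inner hgc φ.integrable).symm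
  ext ξ
  rw [← not_iff_not, spectralSupport, Distribution.notMem_dsupport_iff]
  constructor
  · rintro ⟨s, hs, hso, hξ⟩
    have h0 : ∀ᵐ u, u ∈ s → G u = 0 := by
      apply hso.ae_eq_zero_of_integral_contDiff_smul_eq_zero
      · exact (hcont.locallyIntegrable).locallyIntegrableOn s
      · intro u hu hu' hus
        have h₁ : HasCompactSupport (Complex.ofRealCLM ∘ u) := hu'.comp_left rfl
        have h₂ : ContDiff ℝ (⊤ : ℕ∞) (Complex.ofRealCLM ∘ u) := by fun_prop
        have h₃ : tsupport (h₁.toSchwartzMap h₂) ⊆ s :=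
          (closure_mono (Function.support_subset_iff'.2 fun z hz ↦ by
            simp [Function.notMem_support.1 hz])).trans hus
        have h₄ := hs (h₁.toSchwartzMap h₂) h₃
        beta_reduce at h₄
        rw [key] at h₄
        simpa [mul_comm] using h₄
    have h1 : Set.EqOn G 0 s := Measure.eqOn_open_of_ae_eq
      ((ae_restrict_iff' hso.measurableSet).2 h0) hso hcont.continuousOn continuousOn_const
    exact notMem_tsupport_iff_eventuallyEq.2 (h1.eventuallyEq_of_mem (hso.mem_nhds hξ))
  · intro hξ
    refine ⟨(tsupport G)ᶜ, fun φ hφ ↦ ?_, (isClosed_tsupport G).isOpen_compl, hξ⟩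
    beta_reduce
    rw [key]
    refine integral_eq_zero_of_ae (ae_of_all _ fun u ↦ ?_)
    by_cases hu : u ∈ tsupport G
    · have : φ u = 0 := image_eq_zero_of_notMem_tsupport fun h ↦ hφ h hu
      simp [this]
    · simp [image_eq_zero_of_notMem_tsupport hu]

end GPDeconv

end

/-
A recovered variable `X` is a limit in `L²` of functions of the observations, so it is uncorrelated
with every variable `Z` that is independent of all of them. Take `Z = ∫ x γ` with `γ` annihilated
by all translates of `h`. In the Gaussian space of `x`, this `Z` is asymptotically orthogonal to the
truncated convolutions; comparing characteristic functions, with the characters of the noise as an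
independent factor, `Z` is independent of the observations. Applied to `X = ∫_I x` this gives
`∫_I c = 0` for every interval `I`, where `c τ = Cov(Z, x τ)`, so `c` vanishes by continuity, and
`c 0 = ∫ K_x γ`. Thus `K_x` annihilates every integrable `γ` whose translates `h` annihilates.
The real and imaginary parts of `𝓕 φ`, for `φ` supported off `supp 𝓕[h]`, are such `γ`, because
modulating `φ` does not move its support and translates `𝓕 φ`.
-/

noncomputable section

namespace GPDeconv

section MeasureTheory

variable {α : Type*} [MeasurableSpace α] {μ : Measure α}

lemma inner_toLp_toLp {X Y : α → ℝ} (hX : MemLp X 2 μ) (hY : MemLp Y 2 μ) :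
    inner ℝ (hX.toLp X) (hY.toLp Y) = ∫ a, X a * Y a ∂μ := by
  rw [L2.inner_def]
  refine integral_congr_ae ?_
  filter_upwards [hX.coeFn_toLp, hY.coeFn_toLp] with a hXa hYa
  simp [hXa, hYa, mul_comm]

lemma sq_integral_mul_le {X Y : α → ℝ} (hX : MemLp X 2 μ) (hY : MemLp Y 2 μ) :
    (∫ a, X a * Y a ∂μ) ^ 2 ≤ (∫ a, X a ^ 2 ∂μ) * ∫ a, Y a ^ 2 ∂μ := by
  simpa only [inner_toLp_toLp, sq] using! real_inner_mul_inner_self_le (hX.toLp X) (hY.toLp Y)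

lemma sq_integral_mul_le_of_integrable {u w : α → ℝ} (hu : AEStronglyMeasurable u μ)
    (hw : Integrable w μ) (huw : Integrable (fun a ↦ u a ^ 2 * |w a|) μ) :
    (∫ a, u a * w a ∂μ) ^ 2 ≤ (∫ a, u a ^ 2 * |w a| ∂μ) * ∫ a, |w a| ∂μ := by
  have hsqrt : AEStronglyMeasurable (fun a ↦ √|w a|) μ :=
    Real.continuous_sqrt.comp_aestronglyMeasurable hw.1.norm
  have hX : (fun a ↦ (u a * √|w a|) ^ 2) = fun a ↦ u a ^ 2 * |w a| := by
    ext a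
    rw [mul_pow, Real.sq_sqrt (abs_nonneg _)]
  have hY : (fun a ↦ (w a / √|w a|) ^ 2) = fun a ↦ |w a| := by
    ext a
    rw [div_pow, Real.sq_sqrt (abs_nonneg _), ← sq_abs, sq, mul_self_div_self]
  have hXY : (fun a ↦ u a * √|w a| * (w a / √|w a|)) = fun a ↦ u a * w a := by
    ext a
    obtain ha | ha := eq_or_ne (w a) 0
    · simp [ha]
    · field_simp
  have hX2 : MemLp (fun a ↦ u a * √|w a|) 2 μ :=
    (memLp_two_iff_integrable_sq (hu.mul hsqrt)).2
      (huw.congr (ae_of_all μ fun a ↦ (congrFun hX a).symm))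
  have hY2 : MemLp (fun a ↦ w a / √|w a|) 2 μ :=
    (memLp_two_iff_integrable_sq
      (hw.1.aemeasurable.div hsqrt.aemeasurable).aestronglyMeasurable).2
        (hw.abs.congr (ae_of_all μ fun a ↦ (congrFun hY a).symm))
  simpa only [hX, hY, hXY] using! sq_integral_mul_le hX2 hY2

lemma integral_abs_mul_le {X Y : α → ℝ} (hX : MemLp X 2 μ) (hY : MemLp Y 2 μ) :
    ∫ a, |X a * Y a| ∂μ ≤ ((∫ a, X a ^ 2 ∂μ) + ∫ a, Y a ^ 2 ∂μ) / 2 := by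
  rw [← integral_add hX.integrable_sq hY.integrable_sq, ← integral_div]
  refine integral_mono (hX.integrable_mul hY).abs
    ((hX.integrable_sq.add hY.integrable_sq).div_const 2) fun a ↦ ?_
  change |X a * Y a| ≤ (X a ^ 2 + Y a ^ 2) / 2
  rw [abs_mul]
  linarith [two_mul_le_add_sq |X a| |Y a|, sq_abs (X a), sq_abs (Y a)]

lemma integral_norm_mul_le {p q : ENNReal}
    [p.HolderConjugate q] {f g : α → ℝ} (hf : MemLp f p μ) (hg : MemLp g q μ) :
    ∫ a, ‖f a * g a‖ ∂μ ≤ (eLpNorm f p μ).toReal * (eLpNorm g q μ).toReal := by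
  have hfg : AEStronglyMeasurable (fun a ↦ f a * g a) μ := hf.1.mul hg.1
  have hle : eLpNorm (fun a ↦ f a * g a) 1 μ ≤ eLpNorm f p μ * eLpNorm g q μ :=
    eLpNorm_smul_le_mul_eLpNorm (f := g) (φ := f) hg.1 hf.1
  have h : (eLpNorm (fun a ↦ f a * g a) 1 μ).toReal ≤ (eLpNorm f p μ * eLpNorm g q μ).toReal :=
    ENNReal.toReal_mono (ENNReal.mul_ne_top hf.2.ne hg.2.ne) hle
  rwa [ENNReal.toReal_mul, eLpNorm_one_eq_lintegral_enorm,
    ← integral_norm_eq_lintegral_enorm hfg] at h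

lemma coeFn_sum_smul {ι : Type*} (s : Finset ι) (c : ι → ℝ) (u : ι → Lp ℝ 2 μ) :
    ⇑(∑ i ∈ s, c i • u i) =ᵐ[μ] fun a ↦ ∑ i ∈ s, c i * u i a := by
  filter_upwards [Lp.coeFn_fun_finsetSum s fun i ↦ c i • u i,
    (Filter.eventually_all_finset s).2 fun i _ ↦ Lp.coeFn_smul (c i) (u i)] with a hsum hsmul
  rw [hsum]
  exact Finset.sum_congr rfl fun i hi ↦ hsmul i hi

lemma tendstoInMeasure_pi {ι κ : Type*} [Fintype κ] {E : κ → Type*}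
    [∀ i, PseudoEMetricSpace (E i)] {l : Filter ι} {F : ι → α → ∀ i, E i} {f : α → ∀ i, E i}
    (h : ∀ i, TendstoInMeasure μ (fun n a ↦ F n a i) l fun a ↦ f a i) :
    TendstoInMeasure μ F l f := by
  intro ε hε
  have hsum : Tendsto (fun n ↦ ∑ i, μ {a | ε ≤ edist (F n a i) (f a i)}) l (𝓝 0) := by
    simpa using tendsto_finsetSum Finset.univ fun i _ ↦ h i ε hε
  refine tendsto_of_tendsto_of_tendsto_of_le_of_le tendsto_const_nhds hsum (fun _ ↦ zero_le)
    fun n ↦ ?_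
  refine (measure_mono fun a ha ↦ ?_).trans (measure_iUnion_fintype_le μ _)
  obtain ⟨i, -, hi⟩ := (Finset.le_sup_iff hε).1 (edist_pi_def (F n a) (f a) ▸ ha.out)
  exact Set.mem_iUnion.2 ⟨i, hi⟩

lemma tendsto_integral_comp_mul_of_tendstoInMeasure {E : Type*} [PseudoEMetricSpace E]
    {U : ℕ → α → E} {V : α → E}
    (hU : ∀ n, AEStronglyMeasurable (U n) μ) (hUV : TendstoInMeasure μ U atTop V) {φ : E → ℂ}
    (hφ : Continuous φ) {C : ℝ} (hC : ∀ e, ‖φ e‖ ≤ C) {B : α → ℂ} (hB : Integrable B μ) :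
    Tendsto (fun n ↦ ∫ a, φ (U n a) * B a ∂μ) atTop (𝓝 (∫ a, φ (V a) * B a ∂μ)) := by
  refine tendsto_of_subseq_tendsto fun ns hns ↦ ?_
  obtain ⟨ms, -, hms⟩ := (hUV.comp hns).exists_seq_tendsto_ae
  refine ⟨ms, tendsto_integral_of_dominated_convergence (fun a ↦ C * ‖B a‖)
    (fun n ↦ (hφ.comp_aestronglyMeasurable (hU _)).mul hB.1) (hB.norm.const_mul C)
    (fun n ↦ ae_of_all _ fun a ↦ ?_) ?_⟩
  · rw [norm_mul]
    gcongr
    exact hC _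
  · filter_upwards [hms] with a ha using ((hφ.tendsto _).comp ha).mul_const _

lemma unifIntegrable_of_ae_norm_le {ι : Type*} {u v : ι → α → ℝ} {p : ENNReal}
    (hv : UnifIntegrable v p μ) (huv : ∀ i, ∀ᵐ a ∂μ, ‖u i a‖ ≤ ‖v i a‖) :
    UnifIntegrable u p μ := by
  intro ε hε
  obtain ⟨δ, hδ, H⟩ := hv hε
  refine ⟨δ, hδ, fun i s hs hμs ↦ (eLpNorm_mono_ae ?_).trans (H i s hs hμs)⟩
  filter_upwards [huv i] with a ha
  rw [norm_indicator_eq_indicator_norm, norm_indicator_eq_indicator_norm]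
  exact Set.indicator_le_indicator ha

lemma eq_zero_of_forall_setIntegral_Ioc {g : ℝ → ℝ} (hg : Continuous g)
    (h : ∀ a b, ∫ τ in Set.Ioc a b, g τ = 0) : g = 0 := by
  ext b
  rw [← hg.deriv_integral g 0 b]
  simp [intervalIntegral, h]

end MeasureTheory

section GaussianSpace

variable {Ω T ι : Type*} [MeasurableSpace Ω] {μ : Measure Ω} {X : T → Ω → ℝ}

/-- The Gaussian Hilbert space of a process: the closed linear span of its values in `L²`. The
values enter as the classes in `L²` they represent, so no integrability of `X` is presupposed. -/
def gaussianSpace (X : T → Ω → ℝ) (μ : Measure Ω) : Submodule ℝ (Lp ℝ 2 μ) :=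
  (Submodule.span ℝ {u : Lp ℝ 2 μ | ∃ t, u =ᵐ[μ] X t}).topologicalClosure

lemma exists_ae_eq_sum_of_mem_span {u : Lp ℝ 2 μ}
    (hu : u ∈ Submodule.span ℝ {u : Lp ℝ 2 μ | ∃ t, u =ᵐ[μ] X t}) :
    ∃ c : T →₀ ℝ, u =ᵐ[μ] fun ω ↦ c.sum fun t a ↦ a * X t ω := by
  classical
  induction hu using Submodule.span_induction with
  | mem u hu =>
    obtain ⟨t, ht⟩ := hu
    exact ⟨.single t 1, by simpa using ht⟩
  | zero => exact ⟨0, by simpa using! Lp.coeFn_zero ℝ 2 μ⟩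
  | add u v _ _ hu hv =>
    obtain ⟨⟨c, hc⟩, ⟨d, hd⟩⟩ := hu, hv
    refine ⟨c + d, ?_⟩
    filter_upwards [Lp.coeFn_add u v, hc, hd] with ω hω hcω hdω
    rw [hω, Pi.add_apply, hcω, hdω, Finsupp.sum_add_index' (by simp) (by simp [add_mul])]
  | smul a u _ hu =>
    obtain ⟨c, hc⟩ := hu
    refine ⟨a • c, ?_⟩
    filter_upwards [Lp.coeFn_smul a u, hc] with ω hω hcω
    rw [hω, Pi.smul_apply, hcω, Finsupp.sum_smul_index (by simp), Finsupp.smul_sum]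
    simp only [smul_eq_mul, mul_assoc]

lemma integral_cexp_of_hasGaussianLaw {V : Ω → ℝ} (hV : HasGaussianLaw V μ)
    (h0 : μ[V] = 0) :
    ∫ ω, Complex.exp (V ω * Complex.I) ∂μ = Complex.exp (-((∫ ω, V ω ^ 2 ∂μ) / 2 : ℝ)) := by
  have h := hV.charFun_map_eq 1
  rw [charFun_apply_real, integral_map hV.aemeasurable (by fun_prop)] at h
  simpa [h0, variance_of_integral_eq_zero hV.aemeasurable h0, neg_div] using h

lemma norm_sq_eq_integral_sq (u : Lp ℝ 2 μ) : ‖u‖ ^ 2 = ∫ ω, u ω ^ 2 ∂μ := by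
  rw [← real_inner_self_eq_norm_sq, L2.inner_def]
  simp [sq]

lemma integral_cexp_mul_of_mem_span [IsProbabilityMeasure μ] (hX : IsGaussianProcess X μ)
    (h0 : ∀ t, μ[X t] = 0) {B : Ω → ℂ} (hB : Integrable B μ)
    (hXB : IndepFun (fun ω t ↦ X t ω) B μ) {u : Lp ℝ 2 μ}
    (hu : u ∈ Submodule.span ℝ {u : Lp ℝ 2 μ | ∃ t, u =ᵐ[μ] X t}) :
    ∫ ω, Complex.exp (u ω * Complex.I) * B ω ∂μ =
      Complex.exp (-(‖u‖ ^ 2 / 2 : ℝ)) * ∫ ω, B ω ∂μ := by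
  obtain ⟨c, hc⟩ := exists_ae_eq_sum_of_mem_span hu
  set V : Ω → ℝ := fun ω ↦ ∑ t ∈ c.support, c t * X t ω
  have hV : HasGaussianLaw V μ := (hX.smul c).hasGaussianLaw_fun_sum (I := c.support)
  have hV0 : μ[V] = 0 := by
    rw [integral_finsetSum _ fun t _ ↦ (hX.hasGaussianLaw_eval t).integrable.const_mul _]
    simp [integral_const_mul, h0]
  have hVB : IndepFun (fun ω ↦ Complex.exp (V ω * Complex.I)) B μ := by
    have hφ : Measurable fun p : T → ℝ ↦
        Complex.exp ((∑ t ∈ c.support, c t * p t : ℝ) * Complex.I) := by fun_prop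
    exact hXB.comp hφ measurable_id
  have hVm : AEMeasurable (fun ω ↦ Complex.exp (V ω * Complex.I)) μ :=
    (by fun_prop : Measurable fun r : ℝ ↦ Complex.exp (r * Complex.I)).comp_aemeasurable
      hV.aemeasurable
  have huV : ‖u‖ ^ 2 = ∫ ω, V ω ^ 2 ∂μ := by
    rw [norm_sq_eq_integral_sq]
    exact integral_congr_ae (hc.fun_comp (· ^ 2))
  rw [huV, ← integral_cexp_of_hasGaussianLaw hV hV0,
    ← hVB.integral_fun_mul_eq_mul_integral hVm.aestronglyMeasurable hB.1]
  refine integral_congr_ae ?_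
  filter_upwards [hc] with ω hω
  rw [hω]
  rfl

lemma continuous_cexp_mul_I : Continuous fun r : ℝ ↦ Complex.exp (r * Complex.I) := by fun_prop

lemma integral_cexp_mul_of_mem_gaussianSpace [IsProbabilityMeasure μ] (hX : IsGaussianProcess X μ)
    (h0 : ∀ t, μ[X t] = 0) {B : Ω → ℂ} (hB : Integrable B μ)
    (hXB : IndepFun (fun ω t ↦ X t ω) B μ) {u : Lp ℝ 2 μ} (hu : u ∈ gaussianSpace X μ) :
    ∫ ω, Complex.exp (u ω * Complex.I) * B ω ∂μ =
      Complex.exp (-(‖u‖ ^ 2 / 2 : ℝ)) * ∫ ω, B ω ∂μ := by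
  obtain ⟨v, hv, hvu⟩ := mem_closure_iff_seq_limit.1 hu
  have hlim := tendsto_integral_comp_mul_of_tendstoInMeasure
    (fun n ↦ Lp.aestronglyMeasurable (v n)) (tendstoInMeasure_of_tendsto_Lp hvu)
    continuous_cexp_mul_I (fun r ↦ (Complex.norm_exp_ofReal_mul_I r).le) hB
  refine tendsto_nhds_unique hlim ?_
  simp only [integral_cexp_mul_of_mem_span hX h0 hB hXB (hv _)]
  have hexp : Continuous fun w : Lp ℝ 2 μ ↦ Complex.exp (-(‖w‖ ^ 2 / 2 : ℝ)) := by fun_prop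
  exact ((hexp.tendsto u).comp hvu).mul_const _

lemma integral_cexp_mul_cexp_mul_of_mem_gaussianSpace [IsProbabilityMeasure μ]
    (hX : IsGaussianProcess X μ) (h0 : ∀ t, μ[X t] = 0) {B : Ω → ℂ} (hB : Integrable B μ)
    (hXB : IndepFun (fun ω t ↦ X t ω) B μ) {u v : Lp ℝ 2 μ} (hu : u ∈ gaussianSpace X μ)
    (hv : v ∈ gaussianSpace X μ) :
    ∫ ω, Complex.exp (v ω * Complex.I) * (Complex.exp (u ω * Complex.I) * B ω) ∂μ =
      Complex.exp (-(inner ℝ u v : ℝ)) * ((∫ ω, Complex.exp (u ω * Complex.I) ∂μ) *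
        ∫ ω, Complex.exp (v ω * Complex.I) * B ω ∂μ) := by
  have hu1 := integral_cexp_mul_of_mem_gaussianSpace hX h0 (integrable_const (1 : ℂ))
    (indepFun_const_right _ _) hu
  simp only [mul_one, integral_const, probReal_univ, one_smul] at hu1
  have huv : ∫ ω, Complex.exp (v ω * Complex.I) * (Complex.exp (u ω * Complex.I) * B ω) ∂μ =
      ∫ ω, Complex.exp ((u + v : Lp ℝ 2 μ) ω * Complex.I) * B ω ∂μ := by
    refine integral_congr_ae ?_
    filter_upwards [Lp.coeFn_add u v] with ω hω
    rw [hω, Pi.add_apply, ← mul_assoc, ← Complex.exp_add, Complex.ofReal_add, add_mul, add_comm]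
  rw [huv, hu1, integral_cexp_mul_of_mem_gaussianSpace hX h0 hB hXB hv,
    integral_cexp_mul_of_mem_gaussianSpace hX h0 hB hXB (Submodule.add_mem _ hu hv),
    ← mul_assoc, ← mul_assoc, ← Complex.exp_add, ← Complex.exp_add, norm_add_sq_real]
  congr 2
  push_cast
  ring

variable [Fintype ι]

lemma coeFn_sum_strongDual_single_smul (ℓ : StrongDual ℝ (ι → ℝ)) [DecidableEq ι]
    (u : ι → Lp ℝ 2 μ) :
    ⇑(∑ i, ℓ (Pi.single i 1) • u i) =ᵐ[μ] fun ω ↦ ℓ fun i ↦ u i ω := by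
  filter_upwards [coeFn_sum_smul Finset.univ (fun i ↦ ℓ (Pi.single i 1)) u] with ω hω
  rw [hω, pi_eq_sum_univ' fun i ↦ u i ω, map_sum]
  simp [Pi.single, mul_comm]

lemma integral_cexp_mul_cexp_mul_of_tendstoInMeasure [IsProbabilityMeasure μ]
    (hX : IsGaussianProcess X μ) (h0 : ∀ t, μ[X t] = 0) {Z : Lp ℝ 2 μ} (hZ : Z ∈ gaussianSpace X μ)
    {F : ℕ → ι → Lp ℝ 2 μ} (hF : ∀ k i, F k i ∈ gaussianSpace X μ)
    (hZF : ∀ i, Tendsto (fun k ↦ inner ℝ Z (F k i)) atTop (𝓝 0)) {f : Ω → ι → ℝ}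
    (hf : TendstoInMeasure μ (fun k ω i ↦ F k i ω) atTop f) {B : Ω → ℂ} (hB : Integrable B μ)
    (hXB : IndepFun (fun ω t ↦ X t ω) B μ) (ℓ : StrongDual ℝ (ι → ℝ)) :
    ∫ ω, Complex.exp (ℓ (f ω) * Complex.I) * (Complex.exp (Z ω * Complex.I) * B ω) ∂μ =
      (∫ ω, Complex.exp (Z ω * Complex.I) ∂μ) *
        ∫ ω, Complex.exp (ℓ (f ω) * Complex.I) * B ω ∂μ := by
  classical
  set G : ℕ → Lp ℝ 2 μ := fun k ↦ ∑ i, ℓ (Pi.single i 1) • F k i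
  have hG (k : ℕ) : G k ∈ gaussianSpace X μ :=
    Submodule.sum_mem _ fun i _ ↦ Submodule.smul_mem _ _ (hF k i)
  have hZG : Tendsto (fun k ↦ Complex.exp (-(inner ℝ Z (G k) : ℝ))) atTop (𝓝 1) := by
    have hinner : Tendsto (fun k ↦ (inner ℝ Z (G k) : ℝ)) atTop (𝓝 0) := by
      simp only [G, inner_sum, real_inner_smul_right]
      simpa using tendsto_finsetSum Finset.univ fun i _ ↦ (hZF i).const_mul (ℓ (Pi.single i 1))
    simpa using! ((by fun_prop : Continuous fun r : ℝ ↦ Complex.exp (-r)).tendsto 0).comp hinner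
  have hlim {C : Ω → ℂ} (hC : Integrable C μ) :
      Tendsto (fun k ↦ ∫ ω, Complex.exp (G k ω * Complex.I) * C ω ∂μ) atTop
        (𝓝 (∫ ω, Complex.exp (ℓ (f ω) * Complex.I) * C ω ∂μ)) := by
    refine (tendsto_integral_comp_mul_of_tendstoInMeasure
      (fun k ↦ (aemeasurable_pi_lambda _ fun i ↦
        (Lp.aestronglyMeasurable (F k i)).aemeasurable).aestronglyMeasurable) hf
      (continuous_cexp_mul_I.comp ℓ.continuous)
      (fun p ↦ (Complex.norm_exp_ofReal_mul_I (ℓ p)).le) hC).congr fun k ↦ integral_congr_ae ?_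
    filter_upwards [coeFn_sum_strongDual_single_smul ℓ (F k)] with ω hω
    rw [hω]
    rfl
  have hZB : Integrable (fun ω ↦ Complex.exp (Z ω * Complex.I) * B ω) μ :=
    hB.bdd_mul (continuous_cexp_mul_I.comp_aestronglyMeasurable (Lp.aestronglyMeasurable Z))
      (ae_of_all μ fun ω ↦ (Complex.norm_exp_ofReal_mul_I (Z ω)).le)
  refine tendsto_nhds_unique (hlim hZB) ?_
  simp only [integral_cexp_mul_cexp_mul_of_mem_gaussianSpace hX h0 hB hXB hZ (hG _)]
  simpa using hZG.mul ((hlim hB).const_mul (∫ ω, Complex.exp (Z ω * Complex.I) ∂μ))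

lemma indepFun_add_of_tendstoInMeasure [IsProbabilityMeasure μ] (hX : IsGaussianProcess X μ)
    (h0 : ∀ t, μ[X t] = 0) {Z : Lp ℝ 2 μ} (hZ : Z ∈ gaussianSpace X μ) {F : ℕ → ι → Lp ℝ 2 μ}
    (hF : ∀ k i, F k i ∈ gaussianSpace X μ)
    (hZF : ∀ i, Tendsto (fun k ↦ inner ℝ Z (F k i)) atTop (𝓝 0)) {f n : Ω → ι → ℝ}
    (hf : TendstoInMeasure μ (fun k ω i ↦ F k i ω) atTop f) (hn : AEMeasurable n μ)
    (hXn : IndepFun (fun ω t ↦ X t ω) n μ) :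
    IndepFun Z (fun ω ↦ f ω + n ω) μ := by
  have hfm : AEMeasurable f μ := hf.aemeasurable fun k ↦
    aemeasurable_pi_lambda _ fun i ↦ (Lp.aestronglyMeasurable (F k i)).aemeasurable
  have hZm : AEMeasurable Z μ := (Lp.aestronglyMeasurable Z).aemeasurable
  refine (indepFun_iff_charFunDual_prod hZm (hfm.add hn)).2 fun L ↦ ?_
  set ℓ : StrongDual ℝ (ι → ℝ) := L.comp (.inr ℝ ℝ (ι → ℝ))
  set a : ℝ := L (1, 0)
  have hexp : Measurable fun p : ι → ℝ ↦ Complex.exp (ℓ p * Complex.I) := by fun_prop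
  have hB : Integrable (fun ω ↦ Complex.exp (ℓ (n ω) * Complex.I)) μ :=
    .of_bound (hexp.comp_aemeasurable hn).aestronglyMeasurable 1
      (ae_of_all μ fun ω ↦ (Complex.norm_exp_ofReal_mul_I (ℓ (n ω))).le)
  have hL (z : ℝ) : L.comp (.inl ℝ ℝ (ι → ℝ)) z = a * z := by
    rw [ContinuousLinearMap.comp_apply, ContinuousLinearMap.inl_apply, mul_comm, ← smul_eq_mul,
      ← map_smul, Prod.smul_mk, smul_eq_mul, mul_one, smul_zero]
  have hLprod (z : ℝ) (p : ι → ℝ) : L (z, p) = a * z + ℓ p := by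
    rw [← hL, ← L.comp_inl_add_comp_inr]
  have key := integral_cexp_mul_cexp_mul_of_tendstoInMeasure hX h0 (Submodule.smul_mem _ a hZ) hF
    (fun i ↦ by simpa [real_inner_smul_left] using (hZF i).const_mul a) hf hB
    (hXn.comp measurable_id hexp) ℓ
  have hZL : ∀ᵐ ω ∂μ, (a • Z : Lp ℝ 2 μ) ω = L.comp (.inl ℝ ℝ (ι → ℝ)) (Z ω) := by
    filter_upwards [Lp.coeFn_smul a Z] with ω hω
    rw [hω, hL, Pi.smul_apply, smul_eq_mul]
  simp only [charFunDual_apply]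
  rw [integral_map (hZm.prodMk (hfm.add hn)) (by fun_prop), integral_map hZm (by fun_prop),
    integral_map (hfm.add hn) (by fun_prop)]
  convert key using 1
  · refine integral_congr_ae (hZL.mono fun ω hω ↦ ?_)
    simp only [hω, hLprod, hL, Pi.add_apply, map_add, ← Complex.exp_add]
    push_cast
    ring_nf
  · congr 1
    · exact integral_congr_ae (hZL.mono fun ω hω ↦ by simp only [hω])
    · simp only [Pi.add_apply, map_add, ← Complex.exp_add, ← add_mul, ← Complex.ofReal_add, ℓ]

end GaussianSpace

section PathIntegral

variable {Ω T : Type*} [MeasurableSpace T] {ν : Measure T} {x : T → Ω → ℝ} {w : T → ℝ}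

/-- The integral of the paths of a process against a weight, as a random variable; it takes the
value `0` at the paths for which the integrand is not integrable. -/
def pathIntegral (ν : Measure T) (x : T → Ω → ℝ) (w : T → ℝ) (ω : Ω) : ℝ := ∫ τ, x τ ω * w τ ∂ν

lemma pathIntegral_indicator {s : Set T} (hs : MeasurableSet s) (ω : Ω) :
    pathIntegral ν x (s.indicator w) ω = ∫ τ in s, x τ ω * w τ ∂ν := by
  simp only [← integral_indicator hs, Set.indicator_mul_right, pathIntegral]

lemma pathIntegral_indicator_one {s : Set T} (hs : MeasurableSet s) :
    pathIntegral ν x (s.indicator fun _ ↦ 1) = fun ω ↦ ∫ τ in s, x τ ω ∂ν := by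
  ext ω
  simp only [pathIntegral_indicator hs, mul_one]

variable [MeasurableSpace Ω] {μ : Measure Ω}

/-- A jointly measurable process whose second moments are finite and bounded in time, so that its
path integrals against integrable weights lie in `L²`. -/
structure IsBoundedSecondOrder (x : T → Ω → ℝ) (μ : Measure Ω) : Prop where
  measurable : Measurable (Function.uncurry x)
  memLp : ∀ t, MemLp (x t) 2 μ
  exists_integral_sq_le : ∃ M, ∀ t, ∫ ω, x t ω ^ 2 ∂μ ≤ M

namespace IsBoundedSecondOrder

variable {Y : Ω → ℝ} [SFinite μ]

lemma integrable_prod_sq (hx : IsBoundedSecondOrder x μ) (hw : Integrable w ν) :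
    Integrable (fun p : T × Ω ↦ x p.1 p.2 ^ 2 * |w p.1|) (ν.prod μ) := by
  have hm : AEStronglyMeasurable (fun p : T × Ω ↦ x p.1 p.2 ^ 2 * |w p.1|) (ν.prod μ) :=
    (hx.measurable.pow_const 2).aestronglyMeasurable.mul hw.1.norm.comp_fst
  obtain ⟨M, hM⟩ := hx.exists_integral_sq_le
  refine (integrable_prod_iff hm).2 ⟨ae_of_all _ fun t ↦
    (hx.memLp t).integrable_sq.mul_const |w t|, ?_⟩
  refine (hw.abs.const_mul M).mono' hm.norm.integral_prod_right' (ae_of_all _ fun t ↦ ?_)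
  simp only [norm_mul, norm_pow, Real.norm_eq_abs, sq_abs, abs_abs, integral_mul_const]
  rw [abs_of_nonneg (integral_nonneg fun ω ↦ sq_nonneg (x t ω))]
  gcongr
  exact hM t

lemma integrable_prod (hx : IsBoundedSecondOrder x μ) (hY : MemLp Y 2 μ) (hw : Integrable w ν) :
    Integrable (fun p : T × Ω ↦ Y p.2 * x p.1 p.2 * w p.1) (ν.prod μ) := by
  have hm : AEStronglyMeasurable (fun p : T × Ω ↦ Y p.2 * x p.1 p.2 * w p.1) (ν.prod μ) :=
    (hY.1.comp_snd.mul hx.measurable.aestronglyMeasurable).mul hw.1.comp_fst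
  obtain ⟨M, hM⟩ := hx.exists_integral_sq_le
  refine (integrable_prod_iff hm).2 ⟨ae_of_all _ fun t ↦
    (hY.integrable_mul (hx.memLp t)).mul_const (w t), ?_⟩
  refine (hw.norm.const_mul (((∫ ω, Y ω ^ 2 ∂μ) + M) / 2)).mono' hm.norm.integral_prod_right'
    (ae_of_all _ fun t ↦ ?_)
  simp only [norm_mul _ (w t), integral_mul_const]
  rw [norm_mul, norm_norm, Real.norm_of_nonneg (integral_nonneg fun _ ↦ norm_nonneg _)]
  gcongr
  exact (integral_abs_mul_le hY (hx.memLp t)).trans (by gcongr; exact hM t)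

variable [SFinite ν]

lemma memLp_pathIntegral (hx : IsBoundedSecondOrder x μ) (hw : Integrable w ν) :
    MemLp (pathIntegral ν x w) 2 μ := by
  have hm : AEStronglyMeasurable (pathIntegral ν x w) μ :=
    (hx.measurable.aestronglyMeasurable.mul hw.1.comp_fst).prod_swap.integral_prod_right'
  have hsq := hx.integrable_prod_sq hw
  refine (memLp_two_iff_integrable_sq hm).2 <|
    (hsq.integral_prod_right.mul_const (∫ τ, |w τ| ∂ν)).mono' (hm.pow 2) ?_
  filter_upwards [hsq.prod_left_ae] with ω hω
  rw [Real.norm_of_nonneg (sq_nonneg _)]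
  exact sq_integral_mul_le_of_integrable
    (hx.measurable.comp measurable_prodMk_right).aestronglyMeasurable hw hω

lemma integral_mul_pathIntegral (hx : IsBoundedSecondOrder x μ) (hY : MemLp Y 2 μ)
    (hw : Integrable w ν) :
    ∫ ω, Y ω * pathIntegral ν x w ω ∂μ = ∫ τ, (∫ ω, Y ω * x τ ω ∂μ) * w τ ∂ν := by
  simp only [pathIntegral, ← integral_const_mul, ← integral_mul_const, ← mul_assoc]
  exact (integral_integral_swap (hx.integrable_prod hY hw)).symm

lemma integral_pathIntegral [IsFiniteMeasure μ] (hx : IsBoundedSecondOrder x μ)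
    (h0 : ∀ t, μ[x t] = 0) (hw : Integrable w ν) : μ[pathIntegral ν x w] = 0 := by
  simpa [h0] using hx.integral_mul_pathIntegral (memLp_const (1 : ℝ)) hw

lemma toLp_pathIntegral_mem_gaussianSpace (hx : IsBoundedSecondOrder x μ) (hw : Integrable w ν) :
    (hx.memLp_pathIntegral hw).toLp _ ∈ gaussianSpace x μ := by
  rw [gaussianSpace, ← Submodule.orthogonal_orthogonal_eq_closure, Submodule.mem_orthogonal]
  intro u hu
  have hux (t : T) : ∫ ω, u ω * x t ω ∂μ = 0 := by
    rw [← inner_toLp_toLp (Lp.memLp u) (hx.memLp t), Lp.toLp_coeFn]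
    exact (Submodule.mem_orthogonal' _ u).1 hu _
      (Submodule.subset_span ⟨t, (hx.memLp t).coeFn_toLp⟩)
  rw [← Lp.toLp_coeFn u (Lp.memLp u), inner_toLp_toLp,
    hx.integral_mul_pathIntegral (Lp.memLp u) hw]
  simp [hux]

end IsBoundedSecondOrder

lemma indepFun_pathIntegral_add [IsProbabilityMeasure μ] [SFinite ν]
    (hx : IsBoundedSecondOrder x μ) (hgauss : IsGaussianProcess x μ) (h0 : ∀ t, μ[x t] = 0)
    {ι : Type*} [Finite ι] (hw : Integrable w ν) {g : ℕ → ι → T → ℝ}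
    (hg : ∀ k i, Integrable (g k i) ν)
    (hwg : ∀ i, Tendsto (fun k ↦ ∫ ω, pathIntegral ν x w ω * pathIntegral ν x (g k i) ω ∂μ)
      atTop (𝓝 0)) {f n : Ω → ι → ℝ}
    (hf : ∀ i, TendstoInMeasure μ (fun k ↦ pathIntegral ν x (g k i)) atTop fun ω ↦ f ω i)
    (hn : AEMeasurable n μ) (hxn : IndepFun (fun ω t ↦ x t ω) n μ) :
    IndepFun (pathIntegral ν x w) (fun ω ↦ f ω + n ω) μ := by
  have := Fintype.ofFinite ι
  have hZ := hx.memLp_pathIntegral hw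
  have hF (k : ℕ) (i : ι) := hx.memLp_pathIntegral (hg k i)
  refine (indepFun_add_of_tendstoInMeasure hgauss h0
    (hx.toLp_pathIntegral_mem_gaussianSpace hw) (F := fun k i ↦ (hF k i).toLp _)
    (fun k i ↦ hx.toLp_pathIntegral_mem_gaussianSpace (hg k i))
    (fun i ↦ by simpa only [inner_toLp_toLp] using hwg i)
    (tendstoInMeasure_pi fun i ↦ (hf i).congr_left fun k ↦ (hF k i).coeFn_toLp.symm)
    hn hxn).congr hZ.coeFn_toLp (ae_eq_refl _)

end PathIntegral

section Correlation

variable {G : Type*} [MeasurableSpace G] [AddCommGroup G] {ν : Measure G} {K γ h : G → ℝ}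
  {p q : ENNReal}

/-- The cross-correlation of `K` and `γ`. When `K` is the covariance kernel of a stationary
process `x`, this is the covariance of `∫ x γ` with `x τ`. -/
def correlation (ν : Measure G) (K γ : G → ℝ) (τ : G) : ℝ := ∫ u, K u * γ (u + τ) ∂ν

lemma integral_mul_sub_eq_correlation [MeasurableAdd G] [ν.IsAddRightInvariant] (K γ : G → ℝ)
    (τ : G) : ∫ t, γ t * K (t - τ) ∂ν = correlation ν K γ τ := by
  simpa [correlation, mul_comm] using
    integral_sub_right_eq_self (μ := ν) (fun u ↦ K u * γ (u + τ)) τ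

lemma correlation_comp_sub_right [MeasurableAdd G] [ν.IsAddRightInvariant] (K γ : G → ℝ)
    (s τ : G) : correlation ν (fun u ↦ K (u - s)) γ τ = correlation ν K γ (τ + s) := by
  rw [correlation, ← integral_add_right_eq_self _ s]
  simp only [correlation, add_sub_cancel_right, add_assoc, add_comm s]

lemma continuous_correlation [TopologicalSpace G] [IsTopologicalAddGroup G] [BorelSpace G]
    [ν.IsAddRightInvariant] [IsLocallyFiniteMeasure ν] [ν.InnerRegularCompactLTTop]
    [p.HolderConjugate q] (hq : q ≠ ⊤) (hK : MemLp K p ν) (hγ : MemLp γ q ν) :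
    Continuous (correlation ν K γ) := by
  have : Fact (1 ≤ p) := ⟨ENNReal.HolderConjugate.one_le p q⟩
  have : Fact (1 ≤ q) := ⟨ENNReal.HolderConjugate.one_le q p⟩
  set T : G → C(G, G) := fun τ ↦ ⟨(· + τ), continuous_add_const τ⟩
  have hT : Continuous T := ContinuousMap.continuous_of_continuous_uncurry _
    (continuous_snd.add continuous_fst)
  have hTm (τ : G) : MeasurePreserving (T τ) ν ν := measurePreserving_add_right ν τ
  have hcont := ((ContinuousLinearMap.mul ℝ ℝ).lpPairing ν p q (hK.toLp K)).continuous.comp <|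
    (continuous_const (y := hγ.toLp γ)).compMeasurePreservingLp hT hTm hq
  convert! hcont using 1
  ext τ
  rw [Function.comp_apply, ContinuousLinearMap.lpPairing_eq_integral,
    Lp.toLp_compMeasurePreserving hγ (hTm τ)]
  refine integral_congr_ae ?_
  filter_upwards [hK.coeFn_toLp, (hγ.comp_measurePreserving (hTm τ)).coeFn_toLp] with u hKu hγu
  rw [hKu, hγu]
  rfl

variable [SFinite ν] [MeasurableAdd₂ G] [MeasurableNeg G] [ν.IsAddLeftInvariant] [ν.IsNegInvariant]

lemma integrable_mul_correlation_integrand [p.HolderConjugate q] (hK : MemLp K p ν)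
    (hh : MemLp h q ν) (hγ : Integrable γ ν) :
    Integrable (fun z : G × G ↦ K z.2 * γ (z.2 + z.1) * h z.1) (ν.prod ν) := by
  have hsub (v : G) := Measure.measurePreserving_sub_left ν v
  have hKh (v : G) := MemLp.integrable_mul hK (hh.comp_measurePreserving (hsub v))
  have hm : AEStronglyMeasurable (fun z : G × G ↦ γ z.1 * (K z.2 * h (z.1 - z.2)))
      (ν.prod ν) :=
    hγ.1.comp_fst.mul (hK.1.convolution_integrand (.mul ℝ ℝ) hh.1)
  have hint : Integrable (fun z : G × G ↦ γ z.1 * (K z.2 * h (z.1 - z.2))) (ν.prod ν) := by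
    refine (integrable_prod_iff hm).2 ⟨ae_of_all _ fun v ↦ (hKh v).const_mul (γ v), ?_⟩
    refine (hγ.norm.mul_const ((eLpNorm K p ν).toReal * (eLpNorm h q ν).toReal)).mono'
      hm.norm.integral_prod_right' (ae_of_all _ fun v ↦ ?_)
    simp only [norm_mul (γ v), integral_const_mul]
    rw [norm_mul, norm_norm, Real.norm_of_nonneg (integral_nonneg fun _ ↦ norm_nonneg _)]
    gcongr
    rw [← eLpNorm_comp_measurePreserving hh.1 (hsub v)]
    exact integral_norm_mul_le hK (hh.comp_measurePreserving (hsub v))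
  refine ((measurePreserving_add_prod ν ν).integrable_comp_of_integrable hint).congr
    (ae_of_all _ fun z ↦ ?_)
  simp only [Function.comp_apply, add_comm z.1, add_sub_cancel_left]
  ring

lemma integrable_correlation_mul [p.HolderConjugate q] (hK : MemLp K p ν)
    (hh : MemLp h q ν) (hγ : Integrable γ ν) :
    Integrable (fun τ ↦ correlation ν K γ τ * h τ) ν := by
  simpa only [correlation, ← integral_mul_const] using
    (integrable_mul_correlation_integrand hK hh hγ).integral_prod_left

lemma integral_correlation_mul [p.HolderConjugate q] (hK : MemLp K p ν)
    (hh : MemLp h q ν) (hγ : Integrable γ ν) :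
    ∫ τ, correlation ν K γ τ * h τ ∂ν = ∫ u, K u * correlation ν h γ u ∂ν := by
  simp only [correlation, ← integral_mul_const, ← integral_const_mul]
  rw [integral_integral_swap (integrable_mul_correlation_integrand hK hh hγ)]
  refine integral_congr_ae (ae_of_all ν fun u ↦ integral_congr_ae (ae_of_all ν fun τ ↦ ?_))
  simp only [add_comm u τ]
  ring

end Correlation

section Recovery

variable {Ω : Type*} {mΩ : MeasurableSpace Ω} {μ : Measure Ω} {X Z : Ω → ℝ}

lemma posteriorVariance_ofReal {N : ℕ} (hX : Integrable X μ) (y : Fin N → Ω → ℝ) :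
    posteriorVariance μ (fun ω ↦ (X ω : ℂ)) y =ᵐ[μ]
      Var[X; μ | MeasurableSpace.comap (fun ω i ↦ y i ω) MeasurableSpace.pi] := by
  refine condExp_congr_ae ?_
  filter_upwards [Complex.ofRealCLM.comp_condExp_comm hX
    (m := MeasurableSpace.comap (fun ω i ↦ y i ω) MeasurableSpace.pi)] with ω hω
  have h : (μ[fun ω ↦ (X ω : ℂ) | MeasurableSpace.comap (fun ω i ↦ y i ω) MeasurableSpace.pi]) ω
    = _ := hω.symm
  rw [h]
  simp [← Complex.ofReal_sub, sq_abs]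

lemma integral_mul_condExp_of_indep {m : MeasurableSpace Ω} (hX : MemLp X 2 μ) (hZ : MemLp Z 2 μ)
    (hind : Indep (MeasurableSpace.comap Z inferInstance) m μ) :
    ∫ ω, Z ω * (μ[X | m]) ω ∂μ = μ[Z] * μ[μ[X | m]] := by
  have hi : IndepFun Z (μ[X | m]) μ := (IndepFun_iff_Indep _ _ _).2 <|
    indep_of_indep_of_le_right hind stronglyMeasurable_condExp.measurable.comap_le
  exact hi.integral_fun_mul_eq_mul_integral hZ.1 (hX.condExp one_le_two).1

variable [IsFiniteMeasure μ] {m : ℕ → MeasurableSpace Ω}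

lemma unifIntegrable_condVar (hm : ∀ N, m N ≤ mΩ) (hX : MemLp X 2 μ) :
    UnifIntegrable (fun N ↦ Var[X; μ | m N]) 1 μ := by
  have hsq : Integrable (X ^ 2) μ := hX.integrable_sq
  refine unifIntegrable_of_ae_norm_le (hsq.uniformIntegrable_condExp hm).2.1 fun N ↦ ?_
  have hnonneg : 0 ≤ᵐ[μ] Var[X; μ | m N] := condExp_nonneg (ae_of_all _ fun ω ↦ sq_nonneg _)
  filter_upwards [hnonneg, condVar_ae_le_condExp_sq (hm N) hX] with ω h0 hle
  exact abs_le_abs_of_nonneg h0 hle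

lemma tendsto_integral_condVar (hm : ∀ N, m N ≤ mΩ) (hX : MemLp X 2 μ)
    (h : ∀ᵐ ω ∂μ, Tendsto (fun N ↦ Var[X; μ | m N] ω) atTop (𝓝 0)) :
    Tendsto (fun N ↦ ∫ ω, (X ω - (μ[X | m N]) ω) ^ 2 ∂μ) atTop (𝓝 0) := by
  have hL := tendsto_Lp_finite_of_tendsto_ae le_rfl ENNReal.one_ne_top
    (fun N ↦ (integrable_condVar (m := m N)).1) (MemLp.zero (p := 1) (ε := ℝ))
    (unifIntegrable_condVar hm hX) h
  have hint := tendsto_integral_of_L1' (0 : Ω → ℝ) aestronglyMeasurable_zero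
    (.of_forall fun N ↦ integrable_condVar (m := m N) (X := X)) hL
  simp only [Pi.zero_apply, integral_zero] at hint
  exact hint.congr fun N ↦ integral_condExp (hm N)

lemma integral_mul_eq_zero_of_tendsto_condVar (hm : ∀ N, m N ≤ mΩ) (hX : MemLp X 2 μ)
    (hZ : MemLp Z 2 μ) (hZ0 : μ[Z] = 0)
    (hind : ∀ N, Indep (MeasurableSpace.comap Z inferInstance) (m N) μ)
    (h : ∀ᵐ ω ∂μ, Tendsto (fun N ↦ Var[X; μ | m N] ω) atTop (𝓝 0)) :
    ∫ ω, Z ω * X ω ∂μ = 0 := by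
  have hXm (N : ℕ) : MemLp (μ[X | m N]) 2 μ := hX.condExp one_le_two
  have hres (N : ℕ) : ∫ ω, Z ω * X ω ∂μ = ∫ ω, Z ω * (X ω - (μ[X | m N]) ω) ∂μ := by
    have hsub := integral_sub (hZ.integrable_mul hX) (hZ.integrable_mul (hXm N))
    simp only [Pi.mul_apply, ← mul_sub] at hsub
    rw [hsub, integral_mul_condExp_of_indep hX hZ (hind N), hZ0, zero_mul, sub_zero]
  have hle (N : ℕ) : (∫ ω, Z ω * X ω ∂μ) ^ 2 ≤
      (∫ ω, Z ω ^ 2 ∂μ) * ∫ ω, (X ω - (μ[X | m N]) ω) ^ 2 ∂μ := by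
    rw [hres N]
    exact sq_integral_mul_le hZ (hX.sub (hXm N))
  have hlim := ge_of_tendsto' ((tendsto_integral_condVar hm hX h).const_mul _) hle
  rw [mul_zero] at hlim
  exact sq_nonpos_iff _ |>.1 hlim

end Recovery

section Source

variable {Ω : Type*} [MeasurableSpace Ω] {μ : Measure Ω} [IsProbabilityMeasure μ]
  {x f : ℝ → Ω → ℝ} {Kx h γ w : ℝ → ℝ}

namespace IsSource

lemma integral_mul (hx : IsSource μ x Kx) (s t : ℝ) : ∫ ω, x s ω * x t ω ∂μ = Kx (s - t) := by
  have hL2 (t : ℝ) : MemLp (x t) 2 μ := (hx.gaussian.hasGaussianLaw_eval t).memLp_two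
  simpa [hx.mean_zero, covariance_eq_sub (hL2 s) (hL2 t)] using hx.cov_eq s t

lemma isBoundedSecondOrder (hx : IsSource μ x Kx) : IsBoundedSecondOrder x μ where
  measurable := hx.measurable
  memLp t := (hx.gaussian.hasGaussianLaw_eval t).memLp_two
  exists_integral_sq_le := ⟨Kx 0, fun t ↦ by simp [sq, hx.integral_mul]⟩

lemma measurable_kernel (hx : IsSource μ x Kx) : Measurable Kx := by
  have hKx : Kx = fun u ↦ ∫ ω, x u ω * x 0 ω ∂μ := by simp [hx.integral_mul]
  rw [hKx]
  exact (hx.measurable.mul ((hx.measurable.comp measurable_prodMk_left).comp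
    measurable_snd)).stronglyMeasurable.integral_prod_right'.measurable

lemma abs_kernel_le (hx : IsSource μ x Kx) (u : ℝ) : |Kx u| ≤ Kx 0 := by
  have hL2 := hx.isBoundedSecondOrder.memLp
  have h0 : 0 ≤ Kx 0 := by
    have hsq : 0 ≤ ∫ ω, x 0 ω * x 0 ω ∂μ := integral_nonneg fun ω ↦ mul_self_nonneg (x 0 ω)
    rwa [hx.integral_mul, sub_self] at hsq
  refine abs_le_of_sq_le_sq ?_ h0
  simpa [hx.integral_mul, sq] using sq_integral_mul_le (hL2 u) (hL2 0)

lemma memLp_top_kernel (hx : IsSource μ x Kx) : MemLp Kx ⊤ :=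
  memLp_top_of_bound hx.measurable_kernel.aestronglyMeasurable (Kx 0)
    (ae_of_all _ hx.abs_kernel_le)

lemma memLp_two_kernel (hx : IsSource μ x Kx) (hKx : MemLp Kx 1 ∨ MemLp Kx 2) : MemLp Kx 2 := by
  obtain hKx | hKx := hKx
  · refine (memLp_two_iff_integrable_sq hKx.1).2 ?_
    simp only [sq]
    exact (memLp_one_iff_integrable.1 hKx).bdd_mul hKx.1 (ae_of_all _ hx.abs_kernel_le)
  · exact hKx

lemma exists_holderConjugate_memLp (hx : IsSource μ x Kx) (hKx : MemLp Kx 1 ∨ MemLp Kx 2)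
    (hh : MemLp h 1 ∨ MemLp h 2) :
    ∃ p q : ENNReal, p.HolderConjugate q ∧ MemLp Kx p ∧ MemLp h q := by
  obtain hh | hh := hh
  · exact ⟨⊤, 1, inferInstance, hx.memLp_top_kernel, hh⟩
  · exact ⟨2, 2, inferInstance, hx.memLp_two_kernel hKx, hh⟩

lemma integral_pathIntegral_mul (hx : IsSource μ x Kx) (hγ : Integrable γ) (τ : ℝ) :
    ∫ ω, pathIntegral volume x γ ω * x τ ω ∂μ = correlation volume Kx γ τ := by
  have hx2 := hx.isBoundedSecondOrder
  simp only [mul_comm (pathIntegral volume x γ _)]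
  rw [hx2.integral_mul_pathIntegral (hx2.memLp τ) hγ, ← integral_mul_sub_eq_correlation]
  simp only [← hx.integral_mul, mul_comm]

lemma integral_pathIntegral_mul_pathIntegral (hx : IsSource μ x Kx) (hγ : Integrable γ)
    (hw : Integrable w) :
    ∫ ω, pathIntegral volume x γ ω * pathIntegral volume x w ω ∂μ =
      ∫ τ, correlation volume Kx γ τ * w τ := by
  have hx2 := hx.isBoundedSecondOrder
  rw [hx2.integral_mul_pathIntegral (hx2.memLp_pathIntegral hγ) hw]
  simp only [hx.integral_pathIntegral_mul hγ]

lemma tendsto_integral_pathIntegral_mul_truncation (hx : IsSource μ x Kx) (hγ : Integrable γ)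
    (hw : ∀ k : ℕ, Integrable ((Set.Ioc (-(k : ℝ)) k).indicator w))
    (hint : Integrable fun τ ↦ correlation volume Kx γ τ * w τ) :
    Tendsto (fun k : ℕ ↦ ∫ ω, pathIntegral volume x γ ω *
      pathIntegral volume x ((Set.Ioc (-(k : ℝ)) k).indicator w) ω ∂μ)
      atTop (𝓝 (∫ τ, correlation volume Kx γ τ * w τ)) := by
  have hR : Tendsto (fun k : ℕ ↦ (k : ℝ)) atTop atTop := tendsto_natCast_atTop_atTop
  refine (intervalIntegral_tendsto_integral hint (tendsto_neg_atTop_atBot.comp hR) hR).congr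
    fun k ↦ ?_
  rw [hx.integral_pathIntegral_mul_pathIntegral hγ (hw k), Function.comp_apply,
    intervalIntegral.integral_of_le (neg_le_self k.cast_nonneg),
    ← integral_indicator measurableSet_Ioc]
  simp only [Set.indicator_mul_right]

lemma indepFun_observations (hx : IsSource μ x Kx) (hf : IsConvolution μ x h f)
    {p q : ENNReal} [p.HolderConjugate q] (hKx : MemLp Kx p) (hh : MemLp h q) {ι : Type*}
    [Finite ι] {t : ι → ℝ} {y : ι → Ω → ℝ} (hy : ∀ i, Measurable (y i))
    (hind : IndepFun (fun ω τ ↦ x τ ω) (fun ω i ↦ y i ω - f (t i) ω) μ) (hγ : Integrable γ)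
    (hγh : correlation volume h γ = 0) :
    IndepFun (pathIntegral volume x γ) (fun ω i ↦ y i ω) μ := by
  have hht (i : ι) : MemLp (fun τ ↦ h (τ - t i)) q :=
    hh.comp_measurePreserving (measurePreserving_sub_right volume (t i))
  have hg (k : ℕ) (i : ι) :
      Integrable ((Set.Ioc (-(k : ℝ)) k).indicator fun τ ↦ h (τ - t i)) :=
    (integrable_indicator_iff measurableSet_Ioc).2 <|
      ((hht i).restrict _).integrable (ENNReal.HolderConjugate.one_le q p)
  have hcov (i : ι) : ∫ τ, correlation volume Kx γ τ * h (τ - t i) = 0 := by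
    simp only [integral_correlation_mul hKx (hht i) hγ, correlation_comp_sub_right, hγh,
      Pi.zero_apply, mul_zero, integral_zero]
  have hconv (i : ι) : TendstoInMeasure μ (fun k : ℕ ↦ pathIntegral volume x
      ((Set.Ioc (-(k : ℝ)) k).indicator fun τ ↦ h (τ - t i))) atTop (f (t i)) := by
    refine ((hf.tendsto (t i)).comp tendsto_natCast_atTop_atTop).congr_left fun k ↦
      ae_of_all _ fun ω ↦ ?_
    rw [pathIntegral_indicator measurableSet_Ioc, Function.comp_apply,
      intervalIntegral.integral_of_le (neg_le_self k.cast_nonneg)]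
  have hres : Measurable fun ω i ↦ y i ω - f (t i) ω :=
    measurable_pi_lambda _ fun i ↦ (hy i).sub (hf.measurable (t i))
  convert! indepFun_pathIntegral_add hx.isBoundedSecondOrder hx.gaussian hx.mean_zero hγ hg
    (fun i ↦ hcov i ▸ hx.tendsto_integral_pathIntegral_mul_truncation hγ (hg · i)
      (integrable_correlation_mul hKx (hht i) hγ))
    (f := fun ω i ↦ f (t i) ω) hconv hres.aemeasurable hind using 3
  simp

end IsSource

end Source

section FourierSupport

lemma iteratedDeriv_cexp_const_mul_ofReal (c : ℂ) (n : ℕ) :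
    iteratedDeriv n (fun ξ : ℝ ↦ Complex.exp (c * ξ)) =
      fun ξ : ℝ ↦ c ^ n * Complex.exp (c * ξ) := by
  induction n with
  | zero => simp
  | succ n ih =>
    ext ξ
    have h : HasDerivAt (fun ξ : ℝ ↦ c * (ξ : ℂ)) c ξ := by
      simpa using (Complex.ofRealCLM.hasDerivAt (x := ξ)).const_mul c
    rw [iteratedDeriv_succ, ih, (h.cexp.const_mul (c ^ n)).deriv]
    ring

lemma hasTemperateGrowth_cexp_mul_I (c : ℝ) :
    Function.HasTemperateGrowth fun ξ : ℝ ↦ Complex.exp ((c * Complex.I) * ξ) := by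
  refine ⟨((contDiff_const.mul Complex.ofRealCLM.contDiff).cexp), fun n ↦ ⟨0, |c| ^ n, fun ξ ↦ ?_⟩⟩
  rw [norm_iteratedFDeriv_eq_norm_iteratedDeriv, iteratedDeriv_cexp_const_mul_ofReal, norm_mul,
    norm_pow, norm_mul, mul_right_comm, ← Complex.ofReal_mul, Complex.norm_exp_ofReal_mul_I]
  simp

lemma exists_fourier_eq_translate (φ : 𝓢(ℝ, ℂ)) (v : ℝ) :
    ∃ ψ : 𝓢(ℝ, ℂ), tsupport ψ ⊆ tsupport φ ∧
      ∀ r, (𝓕 ψ : 𝓢(ℝ, ℂ)) r = (𝓕 φ : 𝓢(ℝ, ℂ)) (r + v) := by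
  have ht := hasTemperateGrowth_cexp_mul_I (-2 * Real.pi * v)
  refine ⟨SchwartzMap.smulLeftCLM ℂ
    (fun ξ : ℝ ↦ Complex.exp (((-2 * Real.pi * v : ℝ) * Complex.I) * ξ)) φ,
    (SchwartzMap.tsupport_smulLeftCLM_subset _ _).trans Set.inter_subset_left, fun r ↦ ?_⟩
  simp only [SchwartzMap.fourier_coe, Real.fourier_real_eq_integral_exp_smul]
  congr 1 with ξ
  rw [SchwartzMap.smulLeftCLM_apply_apply ht, smul_eq_mul, smul_eq_mul, smul_eq_mul, ← mul_assoc,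
    ← Complex.exp_add]
  congr 2
  push_cast
  ring

variable {p q : ENNReal} {g K h : ℝ → ℝ}

lemma apply_integral_mul_schwartz (hp : 1 ≤ p) (hg : MemLp g p) (φ : 𝓢(ℝ, ℂ)) (L : ℂ →L[ℝ] ℝ) :
    L (∫ t, (g t : ℂ) * φ t) = ∫ t, g t * L (φ t) := by
  have := ENNReal.HolderConjugate.conjExponent hp
  have hgφ : Integrable fun t ↦ (g t : ℂ) * φ t :=
    MemLp.integrable_mul hg.ofReal (φ.memLp p.conjExponent)
  rw [← L.integral_comp_comm hgφ]
  simp only [← Complex.real_smul, map_smul, smul_eq_mul]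

lemma spectralSupport_subset_of_forall_integral_eq_zero (hp : 1 ≤ p) (hK : MemLp K p)
    (hq : 1 ≤ q) (hh : MemLp h q)
    (H : ∀ γ, Integrable γ → correlation volume h γ = 0 → ∫ u, K u * γ u = 0) :
    spectralSupport K ⊆ spectralSupport h := by
  intro ξ
  contrapose
  simp only [spectralSupport, Distribution.notMem_dsupport_iff]
  rintro ⟨s, hs, hso, hξ⟩
  refine ⟨s, fun φ hφ ↦ ?_, hso, hξ⟩
  have key (L : ℂ →L[ℝ] ℝ) : L (∫ t, (K t : ℂ) * (𝓕 φ : 𝓢(ℝ, ℂ)) t) = 0 := by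
    rw [apply_integral_mul_schwartz hp hK]
    refine H _ (L.integrable_comp (𝓕 φ : 𝓢(ℝ, ℂ)).integrable) (funext fun v ↦ ?_)
    obtain ⟨ψ, hψφ, hψ⟩ := exists_fourier_eq_translate φ v
    simp only [correlation, ← hψ]
    have hhψ : ∫ t, (h t : ℂ) * (𝓕 ψ : 𝓢(ℝ, ℂ)) t = 0 := hs ψ (hψφ.trans hφ)
    rw [← apply_integral_mul_schwartz hq hh, hhψ, map_zero, Pi.zero_apply]
  exact Complex.ext (key Complex.reCLM) (key Complex.imCLM)

end FourierSupport

section SpectralRecovery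

lemma windowedSpectrum_zero {Ω : Type*} (x : ℝ → Ω → ℝ) (w : ℝ → ℝ) :
    windowedSpectrum x w 0 = fun ω ↦ (pathIntegral volume x w ω : ℂ) := by
  ext ω
  simp only [windowedSpectrum, Real.fourier_real_eq_integral_exp_smul, pathIntegral,
    ← integral_complex_ofReal]
  simp [mul_comm]

variable {Ω : Type*} [MeasurableSpace Ω] {μ : Measure Ω} [IsProbabilityMeasure μ]
  {x f : ℝ → Ω → ℝ} {Kx h γ : ℝ → ℝ}

lemma integrable_indicator_Ioc_one (a b : ℝ) :
    Integrable ((Set.Ioc a b).indicator fun _ ↦ (1 : ℝ)) :=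
  (integrable_indicator_iff measurableSet_Ioc).2 (integrableOn_const (by simp))

lemma SuccessfullyRecovered.tendsto_condVar_setIntegral (hx : IsBoundedSecondOrder x μ)
    {y : (N : ℕ) → Fin N → Ω → ℝ} (hrec : SuccessfullyRecovered μ x y) (a b : ℝ) :
    ∀ᵐ ω ∂μ, Tendsto (fun N ↦ Var[fun ω ↦ ∫ τ in Set.Ioc a b, x τ ω; μ |
      MeasurableSpace.comap (fun ω i ↦ y N i ω) MeasurableSpace.pi] ω) atTop (𝓝 0) := by
  have hw := integrable_indicator_Ioc_one a b
  have hwc : HasCompactSupport ((Set.Ioc a b).indicator fun _ ↦ (1 : ℝ)) :=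
    .intro isCompact_Icc fun τ hτ ↦
      Set.indicator_of_notMem (fun h ↦ hτ (Set.Ioc_subset_Icc_self h)) _
  have hX := (hx.memLp_pathIntegral hw).integrable one_le_two
  filter_upwards [hrec 0 _ hw hwc, ae_all_iff.2 fun N ↦ posteriorVariance_ofReal hX (y N)]
    with ω hlim hvar
  rw [windowedSpectrum_zero] at hlim
  rw [← pathIntegral_indicator_one measurableSet_Ioc]
  exact hlim.congr hvar

lemma IsSource.integral_kernel_mul_eq_zero (hx : IsSource μ x Kx) (hγ : Integrable γ)
    {m : ℕ → MeasurableSpace Ω} (hm : ∀ N, m N ≤ ‹MeasurableSpace Ω›)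
    (hind : ∀ N, Indep (MeasurableSpace.comap (pathIntegral volume x γ) inferInstance) (m N) μ)
    (hrec : ∀ a b, ∀ᵐ ω ∂μ, Tendsto
      (fun N ↦ Var[fun ω ↦ ∫ τ in Set.Ioc a b, x τ ω; μ | m N] ω) atTop (𝓝 0)) :
    ∫ u, Kx u * γ u = 0 := by
  have hx2 := hx.isBoundedSecondOrder
  have hzero : correlation volume Kx γ = 0 := by
    refine eq_zero_of_forall_setIntegral_Ioc (continuous_correlation ENNReal.one_ne_top
      hx.memLp_top_kernel (memLp_one_iff_integrable.2 hγ)) fun a b ↦ ?_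
    have hw := integrable_indicator_Ioc_one a b
    have h := integral_mul_eq_zero_of_tendsto_condVar hm (hx2.memLp_pathIntegral hw)
      (hx2.memLp_pathIntegral hγ) (hx2.integral_pathIntegral hx.mean_zero hγ) hind
      (by simpa only [pathIntegral_indicator_one measurableSet_Ioc] using hrec a b)
    rw [hx.integral_pathIntegral_mul_pathIntegral hγ hw] at h
    rw [← h, ← integral_indicator measurableSet_Ioc]
    simp only [← Set.indicator_mul_right, mul_one]
  simpa [correlation] using congrFun hzero 0

end SpectralRecovery

end GPDeconv

end

theorem theorem1_general {Ω : Type*} [MeasurableSpace Ω] (μ : Measure Ω) [IsProbabilityMeasure μ]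
    (x f : ℝ → Ω → ℝ) (Kx h : ℝ → ℝ) {p q : ENNReal} [p.HolderConjugate q]
    (hKx : MemLp Kx p) (hh : MemLp h q) {ι : ℕ → Type*} [∀ N, Finite (ι N)]
    (t : (N : ℕ) → ι N → ℝ) (y : (N : ℕ) → ι N → Ω → ℝ)
    (hx : GPDeconv.IsSource μ x Kx)
    (hf : GPDeconv.IsConvolution μ x h f)
    (hy : ∀ N i, Measurable (y N i))
    (hind : ∀ N, IndepFun (fun ω τ ↦ x τ ω) (fun ω i ↦ y N i ω - f (t N i) ω) μ)
    (hrec : ∀ a b, ∀ᵐ ω ∂μ, Tendsto (fun N ↦ Var[fun ω ↦ ∫ τ in Set.Ioc a b, x τ ω; μ |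
      MeasurableSpace.comap (fun ω i ↦ y N i ω) MeasurableSpace.pi] ω) atTop (𝓝 0)) :
    GPDeconv.spectralSupport Kx ⊆ GPDeconv.spectralSupport h := by
  refine GPDeconv.spectralSupport_subset_of_forall_integral_eq_zero
    (ENNReal.HolderConjugate.one_le p q) hKx (ENNReal.HolderConjugate.one_le q p) hh
    fun γ hγ hγh ↦ hx.integral_kernel_mul_eq_zero hγ
      (fun N ↦ (measurable_pi_lambda _ (hy N)).comap_le) (fun N ↦ ?_) hrec
  exact (IndepFun_iff_Indep _ _ _).1 (hx.indepFun_observations hf hKx hh (hy N) (hind N) hγ hγh)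

theorem theorem1 {Ω : Type*} [MeasurableSpace Ω] (μ : Measure Ω) [IsProbabilityMeasure μ]
    (x f : ℝ → Ω → ℝ) (Kx h : ℝ → ℝ) (v : ℝ≥0)
    (hKx : MemLp Kx 1 ∨ MemLp Kx 2) (hh : MemLp h 1 ∨ MemLp h 2)
    (t : (N : ℕ) → Fin N → ℝ) (y : (N : ℕ) → Fin N → Ω → ℝ)
    (hx : GPDeconv.IsSource μ x Kx)
    (hf : GPDeconv.IsConvolution μ x h f)
    (hy : ∀ N, GPDeconv.IsObservation μ x f v (t N) (y N))
    (hrec : GPDeconv.SuccessfullyRecovered μ x y) :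
    GPDeconv.spectralSupport Kx ⊆ GPDeconv.spectralSupport h := by
  obtain ⟨p, q, _, hKp, hhq⟩ := hx.exists_holderConjugate_memLp hKx hh
  exact theorem1_general μ x f Kx h hKp hhq t y hx hf (fun N ↦ (hy N).measurable)
    (fun N ↦ (hy N).indep_source) (hrec.tendsto_condVar_setIntegral hx.isBoundedSecondOrder)
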